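/- **Setting.** Let $\Omega_0,\Omega\subseteq\mathbb R$ be compact, $\Omega\neq\emptyset$, and let $\mathbb Q$ be a probability measure with $\mathbb Q(\Omega_0)=1$ (the limiting empirical law of the entries of the unknown signal); write $x^0$ for a variable with law $\mathbb Q$. An *inference task* is a pair $(g_0,g)$ of measurable functions of $(y,w)\in\mathbb R\times U$, $U$ an open neighbourhood of $0$, three times continuously differentiable in $w$, together with a measure $dy$ on $\mathbb R$, such that $\int e^{g_0(y,w)}dy=1$ for $w\in U$ and, for $f\in\{g_0,g\}$: $\int e^{f(y,0)}dy<\infty$, $\int|\partial_wf(y,0)|^4e^{g_0(y,0)}dy<\infty$, and $\|\partial_w^2f(\cdot,0)\|_\infty,\ \|\partial_w^3f\|_\infty<\infty$. With $\mathbb E_0$ the expectation under the null law $e^{g_0(y,0)}dy$ of $Y$, its information parameters are $$\beta_1=\mathbb E_0\big[(\partial_wg(Y,0)-\mathbb E_0\partial_wg(Y,0))^2\big],\quad \beta_2=\mathbb E_0[\partial_wg(Y,0)\,\partial_wg_0(Y,0)],$$ $$\beta_3=-\mathbb E_0[\partial_w^2g(Y,0)],\quad \beta_4=\mathbb E_0[\partial_wg(Y,0)].$$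 The task is *well-scored* if $\beta_4=0$. For $S\ge 0$ let $\mathcal A_S$ be the set of finite measures $\gamma=m(t)\,dt+c\,\delta_S$ on $[0,S]$ with $m\ge0$ non-decreasing and $c\ge0$. For $\gamma\in\mathcal A_S$ and $\lambda,\mu\in\mathbb R$ let $\Phi_{\gamma,\lambda,\mu}$ (depending also on $x^0$) be the weak solution on $[0,S]\times\mathbb R$ (continuous, with bounded weak derivative $\partial_y\Phi$) of $$\partial_t\Phi=-\tfrac{\beta_1}{2}\big[\partial_y^2\Phi+m(t)(\partial_y\Phi)^2\big],\qquad \Phi(S,y)=\max_{x\in\Omega}\Big(yx+\lambda xx^0+\big(\mu+\tfrac{\beta_1}{2}c\big)x^2\Big).$$ Put $$\psi_{\bar\beta}(S,M)=\inf_{\gamma\in\mathcal A_S,\,\lambda,\mu\in\mathbb R}\Big\{\mathbb E_{\mathbb Q}[\Phi_{\gamma,\lambda,\mu}(0,0)]-\tfrac{\beta_1}{2}\int_0^S t\,d\gamma(t)-\mu S-\lambda M\Big\}+\tfrac{\beta_2M^2}{2}-\tfrac{\beta_3S^2}{4}\in[-\infty,\infty).$$ Let $\mathcal C\subseteq\mathbb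 R^2$ be the set of $(S,M)$ such that, for all $\rho,\tau\in[-1,1]$, $$\mathbb E_{\mathbb Q}\Big[\inf_{x\in\Omega}(\rho x^2+\tau xx^0)\Big]\le\rho S+\tau M\le\mathbb E_{\mathbb Q}\Big[\sup_{x\in\Omega}(\rho x^2+\tau xx^0)\Big],$$ and let $\mathcal C_{\bar\beta}$ be the set of maximisers of $\psi_{\bar\beta}$ over $\mathcal C$. Two well-scored tasks, with information parameters $\bar\beta$ and $\bar\beta'$, are *coarsely equivalent* if $\mathcal C_{\bar\beta}=\mathcal C_{\bar\beta'}$ (for the same $\Omega$ and $\mathbb Q$). **Theorem.** Let $(g_0^1,g^1)$ and $(g_0^2,g^2)$ be two well-scored inference tasks with information parameters $\beta_i(g^1)$ and $\beta_i(g^2)$. Suppose that at least one of the following holds. 1. The parameters $\sqrt{\beta_1},\beta_2,\beta_3$ have a common positive ratio, $$\frac{\sqrt{\beta_1(g^1)}}{\sqrt{\beta_1(g^2)}}=\frac{\beta_2(g^1)}{\beta_2(g^2)}=\frac{\beta_3(g^1)}{\beta_3(g^2)},$$ that is, there is $r>0$ with $\sqrt{\beta_1(g^1)}=r\sqrt{\beta_1(g^2)}$,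 $\beta_2(g^1)=r\beta_2(g^2)$ and $\beta_3(g^1)=r\beta_3(g^2)$. 2. There is a constant $C$ with $|x|=C$ for every $x\in\Omega$, and there is $r>0$ with $\sqrt{\beta_1(g^1)}=r\sqrt{\beta_1(g^2)}$ and $\beta_2(g^1)=r\beta_2(g^2)$. Then $(g_0^1,g^1)$ and $(g_0^2,g^2)$ are coarsely equivalent. -/

import Mathlib

open MeasureTheory Set
open scoped ContDiff

noncomputable section

/-! ### Inference tasks and their information parameters -/

/-- An inference task: a log-likelihood `g₀` and a pseudo-likelihood `g`, both functions of
`(y, w) ∈ ℝ × U`, where `U` is an open neighbourhood of `0` and `y` is integrated against a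
dominating measure `dy` (Lebesgue or counting measure in the typical cases). Values of `g₀ y w`
and `g y w` at `w ∉ U` play no role. -/
structure InferenceTask where
  /-- the dominating measure `dy` -/
  dy : Measure ℝ
  /-- the neighbourhood of `0` on which the parameter `w` ranges -/
  U : Set ℝ
  /-- the log-likelihood `g₀ (y, w) = log ℙ(Y = y ∣ w)` -/
  g₀ : ℝ → ℝ → ℝ
  /-- the pseudo-likelihood `g (y, w)` -/
  g : ℝ → ℝ → ℝ
  isOpen_U : IsOpen U
  zero_mem_U : (0 : ℝ) ∈ U
  /-- `exp (g₀ (·, w))` is a probability density with respect to `dy`. -/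
  lintegral_exp_g₀ : ∀ w ∈ U, ∫⁻ y, ENNReal.ofReal (Real.exp (g₀ y w)) ∂dy = 1
  measurable_g₀ : Measurable fun p : ℝ × U => g₀ p.1 p.2
  measurable_g : Measurable fun p : ℝ × U => g p.1 p.2
  contDiffOn_g₀ : ∀ y, ContDiffOn ℝ 3 (g₀ y) U
  contDiffOn_g : ∀ y, ContDiffOn ℝ 3 (g y) U
  integrable_exp_g₀ : Integrable (fun y => Real.exp (g₀ y 0)) dy
  integrable_exp_g : Integrable (fun y => Real.exp (g y 0)) dy
  integrable_score_g₀ :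
    Integrable (fun y => |deriv (g₀ y) 0| ^ 4 * Real.exp (g₀ y 0)) dy
  integrable_score_g :
    Integrable (fun y => |deriv (g y) 0| ^ 4 * Real.exp (g₀ y 0)) dy
  bounded_deriv2_g₀ : ∃ K : ℝ, ∀ᵐ y ∂dy, |iteratedDeriv 2 (g₀ y) 0| ≤ K
  bounded_deriv2_g : ∃ K : ℝ, ∀ᵐ y ∂dy, |iteratedDeriv 2 (g y) 0| ≤ K
  bounded_deriv3_g₀ : ∃ K : ℝ, ∀ᵐ y ∂dy, ∀ w ∈ U, |iteratedDeriv 3 (g₀ y) w| ≤ K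
  bounded_deriv3_g : ∃ K : ℝ, ∀ᵐ y ∂dy, ∀ w ∈ U, |iteratedDeriv 3 (g y) w| ≤ K

namespace InferenceTask

/-- The null law `ℙ₀` of one entry, with density `exp (g₀ (y, 0))` with respect to `dy`. -/
def nullLaw (T : InferenceTask) : Measure ℝ :=
  T.dy.withDensity fun y => ENNReal.ofReal (Real.exp (T.g₀ y 0))

/-- `β₄ = 𝔼₀[∂_w g(Y,0)]`, the score parameter. -/
def beta4 (T : InferenceTask) : ℝ := ∫ y, deriv (T.g y) 0 ∂T.nullLaw

/-- `β₁ = 𝔼₀[(∂_w g(Y,0) - 𝔼₀[∂_w g(Y,0)])²]`. -/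
def beta1 (T : InferenceTask) : ℝ :=
  ∫ y, (deriv (T.g y) 0 - ∫ z, deriv (T.g z) 0 ∂T.nullLaw) ^ 2 ∂T.nullLaw

/-- `β₂ = 𝔼₀[∂_w g(Y,0) ∂_w g₀(Y,0)]`. -/
def beta2 (T : InferenceTask) : ℝ :=
  ∫ y, deriv (T.g y) 0 * deriv (T.g₀ y) 0 ∂T.nullLaw

/-- `β₃ = -𝔼₀[∂_w² g(Y,0)]`. -/
def beta3 (T : InferenceTask) : ℝ := -∫ y, iteratedDeriv 2 (T.g y) 0 ∂T.nullLaw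

/-- A task is well-scored if its score parameter vanishes. -/
def WellScored (T : InferenceTask) : Prop := T.beta4 = 0

end InferenceTask

/-! ### The Parisi-type functional -/

/-- Smooth compactly supported test functions of `(t, y) ∈ (0, S) × ℝ`. -/
structure IsTestFunction (S : ℝ) (φ : ℝ × ℝ → ℝ) : Prop where
  smooth : ContDiff ℝ ∞ φ
  compactSupport : HasCompactSupport φ
  support_subset : tsupport φ ⊆ Ioo 0 S ×ˢ univ

/-- `u` is a weak solution on `[0, S] × ℝ` of the Hamilton-Jacobi-Bellman equation
`∂_t u = -(b / 2) (∂_y² u + m(t) (∂_y u)²)`, `u(S, y) = f y`: it is continuous, it attains the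
terminal value, it has a bounded weak derivative `p = ∂_y u`, and the equation holds when it is
tested against smooth compactly supported functions on `(0, S) × ℝ`. -/
structure IsWeakSolution (b S : ℝ) (m f : ℝ → ℝ) (u : ℝ → ℝ → ℝ) : Prop where
  continuousOn : ContinuousOn (fun z : ℝ × ℝ => u z.1 z.2) (Icc 0 S ×ˢ univ)
  terminal : ∀ y, u S y = f y
  equation : ∃ p : ℝ × ℝ → ℝ, Measurable p ∧ (∃ K : ℝ, ∀ z, |p z| ≤ K) ∧
    (∀ φ : ℝ × ℝ → ℝ, IsTestFunction S φ →
      ∫ z : ℝ × ℝ, u z.1 z.2 * deriv (fun y => φ (z.1, y)) z.2 = -∫ z : ℝ × ℝ, p z * φ z) ∧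
    (∀ φ : ℝ × ℝ → ℝ, IsTestFunction S φ →
      ∫ z : ℝ × ℝ, u z.1 z.2 * deriv (fun t => φ (t, z.2)) z.1 =
        b / 2 * ∫ z : ℝ × ℝ, (u z.1 z.2 * iteratedDeriv 2 (fun y => φ (z.1, y)) z.2
          + m z.1 * p z ^ 2 * φ z))

/-- `γ = m(t) dt + c δ_S` belongs to the class `𝒜_S` of finite measures on `[0, S]`: `m` is
non-negative, non-decreasing and integrable, and `c ≥ 0`. -/
structure IsParisiMeasure (S : ℝ) (m : ℝ → ℝ) (c : ℝ) : Prop where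
  nonneg : ∀ t ∈ Ico 0 S, 0 ≤ m t
  monotone : MonotoneOn m (Ico 0 S)
  integrable : IntegrableOn m (Ico 0 S)
  atom_nonneg : 0 ≤ c

/-- The terminal condition `y ↦ max_{x ∈ Ω} (y x + l x x⁰ + (μ + b c / 2) x²)`. -/
def terminalValue (Ω : Set ℝ) (b c l μ x0 y : ℝ) : ℝ :=
  ⨆ x : Ω, (y * x + l * x * x0 + (μ + b / 2 * c) * (x : ℝ) ^ 2)

/-- The values of the functional whose infimum over `(γ, l, μ)`, `γ = m dt + c δ_S`, is
`ψ(S, M)`. For every signal value `x0`, `Φ x0` is the weak solution with the terminal condition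
determined by `x0`. -/
def psiValues (Ω : Set ℝ) (Q : Measure ℝ) (b1 b2 b3 S M : ℝ) : Set ℝ :=
  {r | ∃ (m : ℝ → ℝ) (c l μ : ℝ) (Φ : ℝ → ℝ → ℝ → ℝ),
    IsParisiMeasure S m c ∧
    (∀ x0, IsWeakSolution b1 S m (terminalValue Ω b1 c l μ x0) (Φ x0)) ∧
    r = ∫ x0, Φ x0 0 0 ∂Q - b1 / 2 * ((∫ t in Ico 0 S, t * m t) + S * c)
      - μ * S - l * M + b2 * M ^ 2 / 2 - b3 * S ^ 2 / 4}

/-- The functional `ψ_β(S, M)`, with values in `[-∞, ∞]`. -/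
def psi (Ω : Set ℝ) (Q : Measure ℝ) (b1 b2 b3 S M : ℝ) : EReal :=
  ⨅ r ∈ psiValues Ω Q b1 b2 b3 S M, (r : EReal)

/-- The domain `𝒞` of pairs `(S, M)`. -/
def overlapDomain (Ω : Set ℝ) (Q : Measure ℝ) : Set (ℝ × ℝ) :=
  {z | ∀ ρ ∈ Icc (-1 : ℝ) 1, ∀ τ ∈ Icc (-1 : ℝ) 1,
    ∫ x0, (⨅ x : Ω, (ρ * (x : ℝ) ^ 2 + τ * x * x0)) ∂Q ≤ ρ * z.1 + τ * z.2 ∧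
    ρ * z.1 + τ * z.2 ≤ ∫ x0, (⨆ x : Ω, (ρ * (x : ℝ) ^ 2 + τ * x * x0)) ∂Q}

/-- The set `𝒞_β` of maximisers of `ψ_β` over `𝒞`. -/
def maximizerSet (Ω : Set ℝ) (Q : Measure ℝ) (b1 b2 b3 : ℝ) : Set (ℝ × ℝ) :=
  {z ∈ overlapDomain Ω Q | ∀ z' ∈ overlapDomain Ω Q,
    psi Ω Q b1 b2 b3 z'.1 z'.2 ≤ psi Ω Q b1 b2 b3 z.1 z.2}

/-- Coarse equivalence of two (well-scored) inference tasks, for the parameter set `Ω` and the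
limiting law `Q` of the entries of the signal: the sets of maximisers coincide. -/
def CoarselyEquivalent (Ω : Set ℝ) (Q : Measure ℝ) (T₁ T₂ : InferenceTask) : Prop :=
  maximizerSet Ω Q T₁.beta1 T₁.beta2 T₁.beta3 = maximizerSet Ω Q T₂.beta1 T₂.beta2 T₂.beta3

end

/-! The functional is homogeneous. If `u` solves the equation for `b`, `m`, then `s * u t (s⁻¹ * y)`
solves it for `s ^ 2 * b`, `s⁻¹ * m` (`IsWeakSolution.scale`). Rescaling `γ` by `s⁻¹` and the
multipliers `l`, `μ` by `s` as well, every admissible value is multiplied by `s`, up to a shift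
proportional to `S ^ 2` that measures the mismatch of `b3` (`psiValues_scale`). The shift is zero if
all parameters scale together, and constant on the overlap domain if `|x| = C` on `Ω`, since then `S
= C ^ 2`. So `ψ` changes by an increasing affine map and keeps its maximisers. The argument acts on
the set of admissible values, so uniqueness of weak solutions is never needed. -/

/-! ### Scaling of weak solutions -/

/-- Dilating the second variable by `s` multiplies plane integrals by `s⁻¹`. -/
lemma integral_comp_snd_mul {s : ℝ} (hs : 0 < s) (F : ℝ × ℝ → ℝ) :
    ∫ z : ℝ × ℝ, F (z.1, s * z.2) = s⁻¹ * ∫ z, F z := by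
  have he : MeasurableEmbedding fun z : ℝ × ℝ => (z.1, s * z.2) :=
    ((Homeomorph.refl ℝ).prodCongr (Homeomorph.mulLeft₀ s hs.ne')).measurableEmbedding
  have hmap : Measure.map (fun z : ℝ × ℝ => (z.1, s * z.2)) volume
      = ENNReal.ofReal s⁻¹ • volume := by
    have h := Measure.map_prod_map (volume : Measure ℝ) (volume : Measure ℝ)
      measurable_id (measurable_const_mul s)
    rw [Real.map_volume_mul_left hs.ne', Measure.map_id, Measure.prod_smul_right,
      abs_of_pos (inv_pos.2 hs)] at h
    exact h.symm
  rw [← he.integral_map F, hmap, integral_smul_measure, ENNReal.toReal_ofReal (inv_pos.2 hs).le,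
    smul_eq_mul]

lemma IsTestFunction.comp_snd_mul {S s : ℝ} (hs : s ≠ 0) {φ : ℝ × ℝ → ℝ}
    (h : IsTestFunction S φ) : IsTestFunction S fun z => φ (z.1, s * z.2) := by
  let e : ℝ × ℝ ≃ₜ ℝ × ℝ := (Homeomorph.refl ℝ).prodCongr (Homeomorph.mulLeft₀ s hs)
  refine ⟨h.smooth.comp (by fun_prop), h.compactSupport.comp_homeomorph e, fun z hz => ?_⟩
  have hz' : e z ∈ tsupport φ := by
    have := tsupport_comp_eq_preimage φ e
    exact (this ▸ hz : z ∈ e ⁻¹' tsupport φ)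
  exact ⟨(h.support_subset hz').1, mem_univ _⟩

/-- If `u` solves the equation with parameters `b`, `m`, then `s u(t, y / s)` solves it with
parameters `s² b`, `m / s`. -/
lemma IsWeakSolution.scale {b S s : ℝ} (hs : 0 < s) {m f : ℝ → ℝ} {u : ℝ → ℝ → ℝ}
    (h : IsWeakSolution b S m f u) :
    IsWeakSolution (s ^ 2 * b) S (fun t => s⁻¹ * m t) (fun y => s * f (s⁻¹ * y))
      (fun t y => s * u t (s⁻¹ * y)) := by
  have hs' : s ≠ 0 := hs.ne'
  obtain ⟨p, hp, ⟨K, hK⟩, hy, ht⟩ := h.equation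
  -- This change of variables moves the dilation from the solution to the test function.
  have dilate : ∀ F : ℝ × ℝ → ℝ, ∫ z, F z = s * ∫ z : ℝ × ℝ, F (z.1, s * z.2) := fun F => by
    rw [integral_comp_snd_mul hs, mul_inv_cancel_left₀ hs']
  refine ⟨?_, fun y => by rw [h.terminal], fun z => p (z.1, s⁻¹ * z.2), ?_, ⟨K, fun z => hK _⟩,
    fun φ hφ => ?_, fun φ hφ => ?_⟩
  · exact continuousOn_const.mul (h.continuousOn.comp (f := fun z : ℝ × ℝ => (z.1, s⁻¹ * z.2))
      (by fun_prop) fun z hz => ⟨hz.1, mem_univ _⟩)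
  · exact hp.comp (by fun_prop)
  · have key := hy _ (hφ.comp_snd_mul hs')
    rw [dilate, dilate (fun z => p (z.1, s⁻¹ * z.2) * φ z)]
    simp only [inv_mul_cancel_left₀ hs']
    rw [← mul_neg, ← key]
    congr 2 with z
    rw [deriv_comp_mul_left s (fun y => φ (z.1, y)), smul_eq_mul]
    ring
  · have key := ht _ (hφ.comp_snd_mul hs')
    have hd : ∀ z : ℝ × ℝ, iteratedDeriv 2 (fun y => φ (z.1, s * y)) z.2
        = s ^ 2 * iteratedDeriv 2 (fun y => φ (z.1, y)) (s * z.2) := fun z => by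
      have hc : ContDiff ℝ 2 fun y => φ (z.1, y) :=
        (contDiff_infty.1 hφ.smooth 2).comp (by fun_prop)
      exact congrFun (iteratedDeriv_comp_const_mul hc s) z.2
    rw [dilate, dilate (fun z => s * u z.1 (s⁻¹ * z.2) * iteratedDeriv 2 (fun y => φ (z.1, y)) z.2
      + s⁻¹ * m z.1 * p (z.1, s⁻¹ * z.2) ^ 2 * φ z)]
    simp only [inv_mul_cancel_left₀ hs', mul_assoc, integral_const_mul] at key ⊢
    rw [key]
    have : ∀ z : ℝ × ℝ, s * (u z.1 z.2 * iteratedDeriv 2 (fun y => φ (z.1, y)) (s * z.2))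
        + s⁻¹ * (m z.1 * (p z ^ 2 * φ (z.1, s * z.2)))
        = s⁻¹ * (u z.1 z.2 * iteratedDeriv 2 (fun y => φ (z.1, s * y)) z.2
          + m z.1 * (p z ^ 2 * φ (z.1, s * z.2))) := fun z => by
      rw [hd]; field_simp
    simp only [this, integral_const_mul]
    field_simp

lemma IsParisiMeasure.scale {S c s : ℝ} (hs : 0 < s) {m : ℝ → ℝ} (h : IsParisiMeasure S m c) :
    IsParisiMeasure S (fun t => s⁻¹ * m t) (s⁻¹ * c) where
  nonneg t ht := mul_nonneg (inv_pos.2 hs).le (h.nonneg t ht)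
  monotone _ hx _ hy hxy := mul_le_mul_of_nonneg_left (h.monotone hx hy hxy) (inv_pos.2 hs).le
  integrable := h.integrable.const_mul _
  atom_nonneg := mul_nonneg (inv_pos.2 hs).le h.atom_nonneg

lemma terminalValue_scale (Ω : Set ℝ) {s : ℝ} (hs : 0 < s) (b c l μ x0 y : ℝ) :
    terminalValue Ω (s ^ 2 * b) (s⁻¹ * c) (s * l) (s * μ) x0 y
      = s * terminalValue Ω b c l μ x0 (s⁻¹ * y) := by
  unfold terminalValue
  rw [Real.mul_iSup_of_nonneg hs.le]
  congr 1 with x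
  field_simp

/-! ### Scaling of the functional and of its maximisers -/

/-- In the `γ` term, `s ^ 2` from `b1` meets `s⁻¹` from `γ`, leaving the common factor `s`. The
target `b3'` stays free so that both cases of the theorem are covered. -/
lemma psiValues_scale {Ω : Set ℝ} {Q : Measure ℝ} {b1 b2 b3 S M s a : ℝ} (hs : 0 < s) (b3' : ℝ)
    (ha : a ∈ psiValues Ω Q b1 b2 b3 S M) :
    s * a + (s * b3 - b3') * S ^ 2 / 4 ∈ psiValues Ω Q (s ^ 2 * b1) (s * b2) b3' S M := by
  obtain ⟨m, c, l, μ, Φ, hγ, hΦ, rfl⟩ := ha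
  refine ⟨_, _, s * l, s * μ, fun x0 t y => s * Φ x0 t (s⁻¹ * y), hγ.scale hs, fun x0 => ?_, ?_⟩
  · have := (hΦ x0).scale hs
    rwa [← funext fun y => terminalValue_scale Ω hs b1 c l μ x0 y] at this
  · have : ∀ t, t * (s⁻¹ * m t) = s⁻¹ * (t * m t) := fun t => by ring
    simp only [this, mul_zero, integral_const_mul]
    field_simp
    ring

/-- Increasing affine maps preserve the order between infima of sets of reals. -/
lemma biInf_coe_le_of_affine {A B A' B' : Set ℝ} {s d : ℝ} (hs : 0 < s)
    (hA : ∀ x ∈ A, s * x + d ∈ A') (hB : ∀ x ∈ B', s⁻¹ * (x - d) ∈ B)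
    (h : ⨅ x ∈ A, (x : EReal) ≤ ⨅ x ∈ B, (x : EReal)) :
    ⨅ x ∈ A', (x : EReal) ≤ ⨅ x ∈ B', (x : EReal) := by
  refine le_iInf₂ fun x hx => le_of_not_gt fun hlt => ?_
  -- A real `q` strictly in between can be pulled back by the affine map within `ℝ`, so infinite
  -- infima need no separate treatment.
  obtain ⟨q, hxq, hq⟩ := EReal.lt_iff_exists_real_btwn.1 hlt
  have hlt' : ⨅ a ∈ A, (a : EReal) < ((s⁻¹ * (q - d) : ℝ) : EReal) := by
    refine (h.trans (iInf₂_le _ (hB x hx))).trans_lt (EReal.coe_lt_coe_iff.2 ?_)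
    have := EReal.coe_lt_coe_iff.1 hxq
    gcongr
  simp only [iInf_lt_iff, EReal.coe_lt_coe_iff] at hlt'
  obtain ⟨a, ha, haq⟩ := hlt'
  rw [lt_inv_mul_iff₀ hs] at haq
  refine (hq.trans_le (iInf₂_le _ (hA a ha))).not_ge (EReal.coe_le_coe_iff.2 ?_)
  linarith

/-- Comparing `ψ` at two points requires the same shift `d` at both, which is what `hd` supplies. -/
lemma maximizerSet_subset_of_scale {Ω : Set ℝ} {Q : Measure ℝ} {b1 b2 b3 b3' s d : ℝ} (hs : 0 < s)
    (hd : ∀ z ∈ overlapDomain Ω Q, (s * b3 - b3') * z.1 ^ 2 / 4 = d) :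
    maximizerSet Ω Q b1 b2 b3 ⊆ maximizerSet Ω Q (s ^ 2 * b1) (s * b2) b3' := by
  refine fun z hz => ⟨hz.1, fun z' hz' => biInf_coe_le_of_affine hs (d := d) (fun x hx => ?_)
    (fun x hx => ?_) (hz.2 z' hz')⟩
  · rw [← hd z' hz']
    exact psiValues_scale hs b3' hx
  · have := psiValues_scale (inv_pos.2 hs) b3 hx
    rw [← mul_assoc, ← mul_pow, ← mul_assoc, inv_mul_cancel₀ hs.ne', one_pow, one_mul,
      one_mul] at this
    convert this using 1
    rw [← hd z hz.1]
    field_simp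
    ring

lemma maximizerSet_eq_of_scale {Ω : Set ℝ} {Q : Measure ℝ} {b1 b2 b3 b3' s d : ℝ} (hs : 0 < s)
    (hd : ∀ z ∈ overlapDomain Ω Q, (s * b3 - b3') * z.1 ^ 2 / 4 = d) :
    maximizerSet Ω Q (s ^ 2 * b1) (s * b2) b3' = maximizerSet Ω Q b1 b2 b3 := by
  refine Subset.antisymm ?_ (maximizerSet_subset_of_scale hs hd)
  -- The inverse scaling has shift `-(s⁻¹ * d)`, because `s⁻¹ * b3' - b3 = -s⁻¹ * (s * b3 - b3')`.
  have h := maximizerSet_subset_of_scale (Q := Q) (Ω := Ω) (b1 := s ^ 2 * b1) (b2 := s * b2)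
    (b3 := b3') (b3' := b3) (d := -(s⁻¹ * d)) (inv_pos.2 hs) fun z hz => by
      rw [← hd z hz]
      field_simp
      ring
  rwa [← mul_assoc, ← mul_pow, ← mul_assoc, inv_mul_cancel₀ hs.ne', one_pow, one_mul,
    one_mul] at h

/-- If all parameters have the same modulus `C`, the overlap domain lies on the line `S = C²`. -/
lemma fst_eq_sq_of_mem_overlapDomain {Ω : Set ℝ} (hΩ : Ω.Nonempty) {Q : Measure ℝ}
    [IsProbabilityMeasure Q] {C : ℝ} (hC : ∀ x ∈ Ω, |x| = C) {z : ℝ × ℝ}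
    (hz : z ∈ overlapDomain Ω Q) : z.1 = C ^ 2 := by
  have : Nonempty Ω := hΩ.to_subtype
  have hsq : ∀ x : Ω, (x : ℝ) ^ 2 = C ^ 2 := fun x => by rw [← hC x x.2, sq_abs]
  -- With `ρ = 1`, `τ = 0` the lower and upper bounds both equal `C ^ 2`.
  have h := hz 1 (by norm_num) 0 (by norm_num)
  simp only [hsq, one_mul, zero_mul, add_zero, ciInf_const, ciSup_const, integral_const,
    probReal_univ, smul_eq_mul] at h
  exact le_antisymm h.2 h.1

lemma InferenceTask.beta1_nonneg (T : InferenceTask) : 0 ≤ T.beta1 :=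
  integral_nonneg fun _ => sq_nonneg _

theorem mainTheorem8 (Ω₀ Ω : Set ℝ) (hΩ₀ : IsCompact Ω₀) (hΩ : IsCompact Ω)
    (hΩne : Ω.Nonempty) (Q : Measure ℝ) [IsProbabilityMeasure Q] (hQ : Q Ω₀ᶜ = 0)
    (T₁ T₂ : InferenceTask) (h₁ : T₁.WellScored) (h₂ : T₂.WellScored)
    (h : (∃ r : ℝ, 0 < r ∧ √T₁.beta1 = r * √T₂.beta1 ∧
            T₁.beta2 = r * T₂.beta2 ∧ T₁.beta3 = r * T₂.beta3) ∨
         ((∃ C : ℝ, ∀ x ∈ Ω, |x| = C) ∧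
          ∃ r : ℝ, 0 < r ∧ √T₁.beta1 = r * √T₂.beta1 ∧ T₁.beta2 = r * T₂.beta2)) :
    CoarselyEquivalent Ω Q T₁ T₂ := by

  have sq_scale : ∀ r : ℝ, √T₁.beta1 = r * √T₂.beta1 → T₁.beta1 = r ^ 2 * T₂.beta1 := fun r hr => by
    rw [← Real.sq_sqrt T₁.beta1_nonneg, hr, mul_pow, Real.sq_sqrt T₂.beta1_nonneg]
  unfold CoarselyEquivalent
  rcases h with ⟨r, hr, e1, e2, e3⟩ | ⟨⟨C, hC⟩, r, hr, e1, e2⟩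
  · rw [sq_scale r e1, e2]
    exact maximizerSet_eq_of_scale hr (d := 0) fun z _ => by rw [e3]; ring
  · rw [sq_scale r e1, e2]
    exact maximizerSet_eq_of_scale hr fun z hz => by
      rw [fst_eq_sq_of_mem_overlapDomain hΩne hC hz]
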